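/- For $t\ge 0$ let $L_t$ be the link diagram given by the closure of the positive braid word $(\sigma_1\sigma_3\sigma_2^4)^t\sigma_1\sigma_3$ on four strands, and let $n(L_t)=6t+2$ be its number of crossings, all of which are positive. Let $\operatorname{Kh}^{i,*}(L_t)$ denote the integral Khovanov homology of $L_t$ in homological degree $i$ (all $q$-degrees together), and let $\operatorname{Kh}_{\mathrm{odd}}^{i,*}(L_t)$ denote its integral odd Khovanov homology. Then for every integer $k\ge 0$ $$ \liminf_{t\to\infty}\frac{\operatorname{rank}\operatorname{Kh}^{n(L_t)-k,*}(L_t)}{\binom{n(L_t)}{k}}\ \ge\ 6^{-k} \qquad\text{and}\qquad \liminf_{t\to\infty}\frac{\operatorname{rank}\operatorname{Kh}_{\mathrm{odd}}^{n(L_t)-k,*}(L_t)}{\binom{n(L_t)}{k}}\ \ge\ 6^{-k}. $$ In particular, for every $k$ there is an $\varepsilon>0$ that bounds both lower limits from below. -/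

import Mathlib

namespace Khovanov

noncomputable section

/-! ### Closures of positive braid words and their resolutions -/

/-- A positive braid word on `m + 1` strands, read from bottom to top. The letter `i : Fin m` is
the positive generator `σ_{i+1}`, crossing the strands in positions `i.castSucc` and `i.succ`.
All its crossings are positive, so the closure has `n₊ = w.length` and `n₋ = 0`. -/
abbrev PosBraidWord (m : ℕ) : Type := List (Fin m)

variable {m : ℕ}

/-- Marked points of the closed braid diagram: the strand positions at the `w.length + 1` levels
separating the crossings. Crossing `c` lies between the levels `c.castSucc` and `c.succ`; the top
level is joined to the bottom level by the closure. -/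
abbrev Point (w : PosBraidWord m) : Type := Fin (w.length + 1) × Fin (m + 1)

/-- The bottom left end of crossing `c`. -/
def botLeft (w : PosBraidWord m) (c : Fin w.length) : Point w := (c.castSucc, (w.get c).castSucc)

/-- The bottom right end of crossing `c`. -/
def botRight (w : PosBraidWord m) (c : Fin w.length) : Point w := (c.castSucc, (w.get c).succ)

/-- The top left end of crossing `c`. -/
def topLeft (w : PosBraidWord m) (c : Fin w.length) : Point w := (c.succ, (w.get c).castSucc)

/-- The top right end of crossing `c`. -/
def topRight (w : PosBraidWord m) (c : Fin w.length) : Point w := (c.succ, (w.get c).succ)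

/-- A vertex of the cube of resolutions: `false` is the 0-smoothing and `true` the 1-smoothing. -/
abbrev Vertex (w : PosBraidWord m) : Type := Fin w.length → Bool

/-- The arcs of the diagram in which crossing `c` is 0-smoothed if `s c = some false`, 1-smoothed
if `s c = some true`, and deleted (its four ends left loose) if `s c = none`. The 0-smoothing of a
positive crossing is the oriented one, made of two vertical strands; the 1-smoothing is made of a
cup and a cap. -/
inductive Arc (w : PosBraidWord m) (s : Fin w.length → Option Bool) : Point w → Point w → Prop
  | closing (p : Fin (m + 1)) : Arc w s (Fin.last w.length, p) (0, p)
  | strand (c : Fin w.length) (p : Fin (m + 1)) (hl : p ≠ (w.get c).castSucc)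
      (hr : p ≠ (w.get c).succ) : Arc w s (c.castSucc, p) (c.succ, p)
  | left (c : Fin w.length) (h : s c = some false) : Arc w s (botLeft w c) (topLeft w c)
  | right (c : Fin w.length) (h : s c = some false) : Arc w s (botRight w c) (topRight w c)
  | bottom (c : Fin w.length) (h : s c = some true) : Arc w s (botLeft w c) (botRight w c)
  | top (c : Fin w.length) (h : s c = some true) : Arc w s (topLeft w c) (topRight w c)

/-- The connected components of the partially smoothed diagram. -/
def Component (w : PosBraidWord m) (s : Fin w.length → Option Bool) : Type := Quot (Arc w s)

/-- The component through a point. -/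
def comp (w : PosBraidWord m) (s : Fin w.length → Option Bool) (p : Point w) : Component w s :=
  Quot.mk _ p

/-- The circles of the complete smoothing at the vertex `α`. -/
abbrev Circle (w : PosBraidWord m) (α : Vertex w) : Type := Component w (fun c => some (α c))

/-- The circle through a point in the smoothing at `α`. -/
abbrev circleAt (w : PosBraidWord m) (α : Vertex w) (p : Point w) : Circle w α :=
  comp w (fun c => some (α c)) p

/-- Changing the 0-smoothing of `c` at the vertex `α` into the 1-smoothing splits a circle, that
is, both strands at `c` lie on the same circle. Otherwise it merges two circles. -/
def Splits (w : PosBraidWord m) (α : Vertex w) (c : Fin w.length) : Prop :=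
  circleAt w α (botLeft w c) = circleAt w α (botRight w c)

/-- The map from the circles at `α` to those at `β` sending each circle to the `β`-circle through a
chosen point of it. Along an edge `α → β` of the cube that merges two circles it is the natural
map, independent of the choices; along an edge that splits a circle it is a section of the natural
map from the circles at `β` to those at `α`. -/
def transfer (w : PosBraidWord m) (α β : Vertex w) (C : Circle w α) : Circle w β :=
  circleAt w β (Quot.out C)

/-- The number of 1-smoothings at a vertex. -/
def height (w : PosBraidWord m) (α : Vertex w) : ℕ :=
  (Finset.univ.filter fun c => α c = true).card

/-! ### Even Khovanov homology -/

/-- `ℤ[X_s : s ∈ S] / (X_s² : s ∈ S)`, i.e. the tensor power `A^{⊗ S}` of `A = ℤ[X]/(X²)`. -/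
abbrev EvenAlg (S : Type) : Type :=
  MvPolynomial S ℤ ⧸ Ideal.span (Set.range fun s : S => (MvPolynomial.X s ^ 2 : MvPolynomial S ℤ))

/-- The class of `X_s`, i.e. `X` in the tensor factor `s` and `1` in all the others. -/
def evenX {S : Type} (s : S) : EvenAlg S := Ideal.Quotient.mk _ (MvPolynomial.X s)

/-- The ring homomorphism `A^{⊗ S} → A^{⊗ S'}` with `X_s ↦ X_{f s}`. -/
def evenMap {S S' : Type} (f : S → S') : EvenAlg S →ₐ[ℤ] EvenAlg S' :=
  Ideal.Quotient.liftₐ _ (MvPolynomial.aeval fun s => evenX (f s)) (by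
    intro a ha
    have h : Ideal.span (Set.range fun s : S => (MvPolynomial.X s ^ 2 : MvPolynomial S ℤ)) ≤
        RingHom.ker (MvPolynomial.aeval (R := ℤ) fun s => evenX (f s)) := by
      rw [Ideal.span_le]
      rintro _ ⟨s, rfl⟩
      simp only [SetLike.mem_coe, RingHom.mem_ker, map_pow, MvPolynomial.aeval_X]
      rw [evenX, ← map_pow, Ideal.Quotient.eq_zero_iff_mem]
      exact Ideal.subset_span ⟨f s, rfl⟩
    exact h ha)

open Classical in
/-- The even edge map for changing crossing `c`, from the vertex `α` to the vertex `β`. For a merge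
it is the multiplication `A ⊗ A → A`. For a split it is the comultiplication `Δ : A → A ⊗ A`, which
is `A`-linear with `Δ 1 = 1 ⊗ X + X ⊗ 1`. All other tensor factors are left alone. -/
def evenEdge (w : PosBraidWord m) (α β : Vertex w) (c : Fin w.length) :
    EvenAlg (Circle w α) →ₗ[ℤ] EvenAlg (Circle w β) :=
  if Splits w α c then
    LinearMap.mulLeft ℤ (evenX (circleAt w β (botLeft w c)) + evenX (circleAt w β (topLeft w c)))
      ∘ₗ (evenMap (transfer w α β)).toLinearMap
  else (evenMap (transfer w α β)).toLinearMap

/-- The sign `(-1)^{#{j < c : α j = 1}}` of the edge of the cube changing `c` at `α`. -/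
def evenSign (w : PosBraidWord m) (α : Vertex w) (c : Fin w.length) : ℤ :=
  (-1) ^ (Finset.univ.filter fun j => j < c ∧ α j = true).card

/-! ### Odd Khovanov homology -/

/-- The exterior algebra on the free abelian group with basis `S`. -/
abbrev OddAlg (S : Type) : Type := ExteriorAlgebra ℤ (S →₀ ℤ)

/-- The generator of the exterior algebra given by `s`. -/
def oddX {S : Type} (s : S) : OddAlg S := ExteriorAlgebra.ι ℤ (Finsupp.single s 1)

/-- The algebra homomorphism induced by a map of generators. -/
def oddMap {S S' : Type} (f : S → S') : OddAlg S →ₐ[ℤ] OddAlg S' :=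
  ExteriorAlgebra.map (Finsupp.lmapDomain ℤ ℤ f)

open Classical in
/-- The odd edge map for changing crossing `c`, from the vertex `α` to the vertex `β`. At every
crossing the arc joining the two strands of the 0-smoothing is oriented from left to right; rotated
by a quarter turn counterclockwise, it points from the cup to the cap of the 1-smoothing. A merge
induces the natural quotient map; a split is the exterior product with
`(circle of the cup) - (circle of the cap)` after any lift. -/
def oddEdge (w : PosBraidWord m) (α β : Vertex w) (c : Fin w.length) :
    OddAlg (Circle w α) →ₗ[ℤ] OddAlg (Circle w β) :=
  if Splits w α c then
    LinearMap.mulLeft ℤ (oddX (circleAt w β (botLeft w c)) - oddX (circleAt w β (topLeft w c)))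
      ∘ₗ (oddMap (transfer w α β)).toLinearMap
  else (oddMap (transfer w α β)).toLinearMap

open Classical in
/-- The product of the four edge signs that an edge assignment must have around the square face of
the cube spanned by crossings `c` and `d` at the vertex `γ` (where both are 0-smoothed).
It is `-1` if the two compositions of edge maps are equal and non-zero, and `1` if they are opposite
and non-zero. If both compositions vanish, a circle with two interleaved arcs on opposite sides of
it is first split and then merged back; there are two such configurations, distinguished by the
orientations of the arcs, and they get opposite values.

- Two splits: the compositions anticommute.
- One crossing splits at `γ` and the other merges: the compositions commute.
- Both split at `γ`, and the second change is a merge: the interleaved configurations. Leave the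
  left strand of `c` upwards, and ask whether the left strand of `d` is met before returning to `c`.
- Both merge at `γ`, and the second change is a split: two circles joined by two arcs. The
  compositions are exterior products with `± (x - y)` for the same two circles `x`, `y`; they are
  opposite exactly if the cups of `c` and `d` end up on different circles.
- Merges only: the compositions commute. -/
def faceSign (w : PosBraidWord m) (γ : Vertex w) (c d : Fin w.length) : ℤ :=
  if Splits w γ c then
    if Splits w γ d then
      if Splits w (Function.update γ c true) d then 1
      else
        let s : Fin w.length → Option Bool := Function.update (fun e => some (γ e)) c none
        if comp w s (topLeft w c) = comp w s (botLeft w d) then 1 else -1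
    else -1
  else
    if Splits w γ d then -1
    else if Splits w (Function.update γ c true) d then
      let β : Vertex w := Function.update (Function.update γ c true) d true
      if circleAt w β (botLeft w c) = circleAt w β (botLeft w d) then -1 else 1
    else -1

/-- The vertex that agrees with `α` at the crossings up to `d` and is 1-smoothed after `d`. -/
def fillAbove (w : PosBraidWord m) (α : Vertex w) (d : Fin w.length) : Vertex w :=
  fun e => if e ≤ d then α e else true

/-- The sign of the edge changing `c` at `α` in the edge assignment of the cube normalized to be `1`
on the edges changing the last 0-smoothed crossing (these form a spanning tree). Its values on
the other edges are forced by the signs of the faces: 1-smooth the 0-smoothed crossings after `c`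
one by one from the last, and multiply the signs of the faces met. Edge assignments
with the same face signs give isomorphic complexes. -/
def oddSign (w : PosBraidWord m) (α : Vertex w) (c : Fin w.length) : ℤ :=
  ∏ d ∈ Finset.univ.filter (fun d => c < d ∧ α d = false), faceSign w (fillAbove w α d) c d

/-! ### The complexes and their homology -/

/-- The total differential on `⨁_α V α`: the component of `d v` at `β` is the signed sum, over the
crossings `c` that are 1-smoothed at `β`, of the edge maps from the vertex with `c` 0-smoothed. -/
def cubeDiff (w : PosBraidWord m) (V : Vertex w → Type) [∀ α, AddCommGroup (V α)]
    (edge : ∀ α β : Vertex w, Fin w.length → (V α →ₗ[ℤ] V β))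
    (sign : Vertex w → Fin w.length → ℤ) : (∀ α, V α) →ₗ[ℤ] (∀ α, V α) :=
  LinearMap.pi fun β => ∑ c ∈ Finset.univ.filter (fun c => β c = true),
    sign (Function.update β c false) c •
      (edge (Function.update β c false) β c ∘ₗ LinearMap.proj (Function.update β c false))

/-- The part of `⨁_α V α` in homological degree `i`, i.e. supported on the vertices of height `i`
(there is no shift as there are no negative crossings). -/
def degreePart (w : PosBraidWord m) (V : Vertex w → Type) [∀ α, AddCommGroup (V α)] (i : ℤ) :
    Submodule ℤ (∀ α, V α) where
  carrier := {v | ∀ α, (height w α : ℤ) ≠ i → v α = 0}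
  zero_mem' := fun _ _ => rfl
  add_mem' := fun hu hv α h => by simp [hu α h, hv α h]
  smul_mem' := fun a v hv α h => by simp [hv α h]

/-- The homology in degree `i`: the cycles of degree `i` modulo the images of the chains of degree
`i - 1`. -/
abbrev CubeHomology (w : PosBraidWord m) (V : Vertex w → Type) [∀ α, AddCommGroup (V α)]
    (D : (∀ α, V α) →ₗ[ℤ] (∀ α, V α)) (i : ℤ) : Type :=
  ↥(LinearMap.ker D ⊓ degreePart w V i) ⧸
    ((degreePart w V (i - 1)).map D).comap (LinearMap.ker D ⊓ degreePart w V i).subtype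

/-- The Khovanov differential of the closure of `w`. -/
def evenDiff (w : PosBraidWord m) :
    (∀ α : Vertex w, EvenAlg (Circle w α)) →ₗ[ℤ] (∀ α : Vertex w, EvenAlg (Circle w α)) :=
  cubeDiff w (fun α => EvenAlg (Circle w α)) (evenEdge w) (evenSign w)

/-- The odd Khovanov differential of the closure of `w`. -/
def oddDiff (w : PosBraidWord m) :
    (∀ α : Vertex w, OddAlg (Circle w α)) →ₗ[ℤ] (∀ α : Vertex w, OddAlg (Circle w α)) :=
  cubeDiff w (fun α => OddAlg (Circle w α)) (oddEdge w) (oddSign w)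

/-- The integral Khovanov homology `Kh^{i,*}` of the closure of `w`, all `q`-degrees together. -/
abbrev Kh (w : PosBraidWord m) (i : ℤ) : Type :=
  CubeHomology w (fun α => EvenAlg (Circle w α)) (evenDiff w) i

/-- The integral odd Khovanov homology in homological degree `i` of the closure of `w`, all
`q`-degrees together. -/
abbrev OddKh (w : PosBraidWord m) (i : ℤ) : Type :=
  CubeHomology w (fun α => OddAlg (Circle w α)) (oddDiff w) i

/-- The braid word `(σ₁ σ₃ σ₂⁴)^t σ₁ σ₃` on four strands. -/
def linkWord (t : ℕ) : PosBraidWord 3 := (List.replicate t [0, 2, 1, 1, 1, 1]).flatten ++ [0, 2]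

/-- The number of crossings of the closure of `w`. -/
def crossings (w : PosBraidWord m) : ℕ := w.length

end

end Khovanov

/-!
The word consists of `t` blocks `σ₁ σ₃ σ₂⁴`, block `i` being made of the crossings with indices
`6 i, …, 6 i + 5`, followed by `σ₁ σ₃`. The rank in degree `n - k` is bounded below by `t.choose k`,
the number of sets `S` of `k` blocks, which suffices as `t.choose k / (6 t + 2).choose k` tends to
`6⁻ᵏ`.

Call a vertex of the cube transversal to `S` if it is 1-smoothed except at one crossing `σ₂` in each
block of `S`. The chain `z_S` with the entry `1` at all transversal vertices, and `0` elsewhere, is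
a cycle. Indeed, 1-smoothing the chosen crossing of a block is a split, whose value at `1` is
`x_j + x_{j+1}` in the even and `x_j - x_{j+1}` in the odd theory, where `x_j` is the circle below
the `j`-th crossing `σ₂` of the block. As the outer circle of the block closes up, `x_4 = x_0`.
The even edge signs alternate in `j` and the odd ones are all `1`, so the four contributions of the
block cancel (`evenDiff_transversalChain`, `oddDiff_transversalChain`).

Conversely, let `ε_S` be the augmentation of the entry at the vertex that is 0-smoothed precisely at
the first `σ₂` of each block of `S`. All edges of the cube into this vertex are splits
(`splits_update_firstVertex`), whose images have augmentation zero, so `ε_S` vanishes on boundaries.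
Since `ε_S z_{S'}` is `1` if `S = S'` and `0` otherwise, the classes of the `z_S` are linearly
independent (`card_le_finrank_cubeHomology`).

The geometric input is only that certain edges are splits, that is, that certain points lie on a
common circle, and so can be shown by exhibiting paths (`Sparse.splits`).
-/

namespace Khovanov

noncomputable section

open Filter Topology

/-! ### Homology of a cube: a rank bound by pairing cycles with cocycles -/

/-- Cycles `z` and functionals `ε` that vanish on boundaries, paired by the identity matrix, show
that the homology has rank at least the number of cycles. Finiteness of the chain groups matters
since `Module.finrank` is `0` for modules of infinite rank. -/
theorem card_le_finrank_cubeHomology {m : ℕ} (w : PosBraidWord m) (V : Vertex w → Type)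
    [∀ α, AddCommGroup (V α)] [∀ α, Module.Finite ℤ (V α)]
    (D : (∀ α, V α) →ₗ[ℤ] (∀ α, V α)) (i : ℤ) {ι : Type*} [Fintype ι] [DecidableEq ι]
    (z : ι → ∀ α, V α) (ε : ι → ((∀ α, V α) →ₗ[ℤ] ℤ))
    (hz : ∀ a, D (z a) = 0) (hdeg : ∀ a, z a ∈ degreePart w V i)
    (hε : ∀ a v, ε a (D v) = 0) (hδ : ∀ a b, ε a (z b) = if a = b then 1 else 0) :
    Fintype.card ι ≤ Module.finrank ℤ (CubeHomology w V D i) := by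
  let K := LinearMap.ker D ⊓ degreePart w V i
  let B := ((degreePart w V (i - 1)).map D).comap K.subtype
  let y : ι → K := fun a => ⟨z a, hz a, hdeg a⟩
  have hB : ∀ a, B ≤ LinearMap.ker (ε a ∘ₗ K.subtype) := by
    rintro a x ⟨v, -, hv⟩
    have : ε a (K.subtype x) = 0 := by rw [← hv]; exact hε a v
    simpa using this
  let η : ι → ((K ⧸ B) →ₗ[ℤ] ℤ) := fun a => B.liftQ (ε a ∘ₗ K.subtype) (hB a)
  have hη : ∀ a b, η a (B.mkQ (y b)) = if a = b then 1 else 0 := fun a b => hδ a b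
  have hli : LinearIndependent ℤ fun a => B.mkQ (y a) := by
    rw [Fintype.linearIndependent_iff]
    intro g hg a
    have := congrArg (η a) hg
    simpa only [map_sum, map_smul, hη, smul_eq_mul, mul_ite, mul_one, mul_zero, map_zero,
      Finset.sum_ite_eq, Finset.mem_univ, if_true] using this
  have : Module.Finite ℤ (K ⧸ B) := inferInstance
  exact hli.fintype_card_le_finrank

/-! ### The two algebras: finiteness and augmentations -/

instance {S : Type} [Finite S] : Module.Finite ℤ (EvenAlg S) := by
  have h := fg_adjoin_of_finite (R := ℤ) (s := Set.range (evenX (S := S))) (Set.finite_range _) (by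
    rintro _ ⟨s, rfl⟩
    refine ⟨Polynomial.X ^ 2, Polynomial.monic_X_pow 2, ?_⟩
    rw [Polynomial.eval₂_pow, Polynomial.eval₂_X, evenX, ← map_pow,
      Ideal.Quotient.eq_zero_iff_mem]
    exact Ideal.subset_span ⟨s, rfl⟩)
  have htop : Algebra.adjoin ℤ (Set.range (evenX (S := S))) = ⊤ := by
    have := congrArg (Subalgebra.map (Ideal.Quotient.mkₐ ℤ
      (Ideal.span (Set.range fun s : S => (MvPolynomial.X s ^ 2 : MvPolynomial S ℤ)))))
      (MvPolynomial.adjoin_range_X (R := ℤ) (σ := S))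
    rw [AlgHom.map_adjoin, ← Set.range_comp, Algebra.map_top,
      (AlgHom.range_eq_top _).2 (Ideal.Quotient.mkₐ_surjective _ _)] at this
    exact this
  rw [htop] at h
  exact ⟨h⟩

instance {S : Type} [Finite S] : Module.Finite ℤ (OddAlg S) := by
  cases nonempty_fintype S
  let _ : LinearOrder S := LinearOrder.lift' (Fintype.equivFin S) (Fintype.equivFin S).injective
  exact Module.Finite.of_basis (Finsupp.basisSingleOne (R := ℤ) (ι := S)).ExteriorAlgebra

/-- The augmentation `X_s ↦ 0` of `EvenAlg S`. -/
def evenAug (S : Type) : EvenAlg S →ₐ[ℤ] ℤ :=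
  Ideal.Quotient.liftₐ _ (MvPolynomial.aeval fun _ => 0) (by
    intro a ha
    have h : Ideal.span (Set.range fun s : S => (MvPolynomial.X s ^ 2 : MvPolynomial S ℤ)) ≤
        RingHom.ker (MvPolynomial.aeval (R := ℤ) fun _ : S => (0 : ℤ)) := by
      rw [Ideal.span_le]
      rintro _ ⟨s, rfl⟩
      simp
    exact h ha)

@[simp] theorem evenAug_evenX {S : Type} (s : S) : evenAug S (evenX s) = 0 := by
  change MvPolynomial.aeval (R := ℤ) (fun _ : S => (0 : ℤ)) (MvPolynomial.X s) = 0
  simp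

/-- The augmentation of the exterior algebra. -/
abbrev oddAug (S : Type) : OddAlg S →ₐ[ℤ] ℤ := ExteriorAlgebra.algebraMapInv

@[simp] theorem oddAug_oddX {S : Type} (s : S) : oddAug S (oddX s) = 0 := by
  simp [oddAug, oddX, ExteriorAlgebra.algebraMapInv]

section Edges

variable {m : ℕ} (w : PosBraidWord m) (α β : Vertex w) (c : Fin w.length)

theorem evenAug_evenEdge (h : Splits w α c) (x : EvenAlg (Circle w α)) :
    evenAug _ (evenEdge w α β c x) = 0 := by
  simp [evenEdge, h]

theorem oddAug_oddEdge (h : Splits w α c) (x : OddAlg (Circle w α)) :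
    oddAug _ (oddEdge w α β c x) = 0 := by
  simp [oddEdge, h]

theorem evenEdge_one (h : Splits w α c) : evenEdge w α β c 1 =
    evenX (circleAt w β (botLeft w c)) + evenX (circleAt w β (topLeft w c)) := by
  simp [evenEdge, h]

theorem oddEdge_one (h : Splits w α c) : oddEdge w α β c 1 =
    oddX (circleAt w β (botLeft w c)) - oddX (circleAt w β (topLeft w c)) := by
  simp [oddEdge, h]

theorem cubeDiff_apply (V : Vertex w → Type) [∀ α, AddCommGroup (V α)]
    (edge : ∀ α β : Vertex w, Fin w.length → (V α →ₗ[ℤ] V β))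
    (sign : Vertex w → Fin w.length → ℤ) (v : ∀ α, V α) :
    cubeDiff w V edge sign v β = ∑ c ∈ Finset.univ.filter (fun c => β c = true),
      sign (Function.update β c false) c •
        edge (Function.update β c false) β c (v (Function.update β c false)) := by
  simp [cubeDiff]

instance (s : Fin w.length → Option Bool) : Finite (Component w s) :=
  inferInstanceAs (Finite (Quot _))

end Edges

/-! ### Asymptotics of the binomial coefficients -/

theorem tendsto_choose_div_choose_linear (k a b : ℕ) (ha : a ≠ 0) :
    Tendsto (fun t : ℕ => (t.choose k : ℝ) / ((a * t + b).choose k : ℝ)) atTop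
      (𝓝 ((1 / a : ℝ) ^ k)) := by
  have hlin : Tendsto (fun t : ℕ => a * t + b) atTop atTop :=
    tendsto_atTop_mono (fun t => (Nat.le_mul_of_pos_left t (Nat.pos_of_ne_zero ha)).trans
      (Nat.le_add_right _ _)) tendsto_id
  have h := (isEquivalent_choose k).div ((isEquivalent_choose k).comp_tendsto hlin)
  refine h.symm.tendsto_nhds ?_
  have h1 : Tendsto (fun t : ℕ => (t : ℝ) / (a * t + b)) atTop (𝓝 (1 / a)) := by
    have h2 : Tendsto (fun t : ℕ => 1 / ((a : ℝ) + b / t)) atTop (𝓝 (1 / (a + 0))) :=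
      tendsto_const_nhds.div (tendsto_const_nhds.add (tendsto_const_div_atTop_nhds_zero_nat _))
        (by simpa using ha)
    rw [add_zero] at h2
    refine h2.congr' ?_
    filter_upwards [eventually_gt_atTop 0] with t ht
    have : (t : ℝ) ≠ 0 := by positivity
    field_simp
  refine (h1.pow k).congr fun t => ?_
  simp only [Pi.div_apply, Function.comp_apply, Nat.cast_add, Nat.cast_mul, div_pow]
  rw [div_div_div_cancel_right₀ (by positivity)]

theorem le_liminf_div_choose (k a b : ℕ) (ha : a ≠ 0) (r : ℕ → ℕ)
    (h : ∀ᶠ t in atTop, t.choose k ≤ r t) :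
    (((1 / a : ℝ) ^ k : ℝ) : EReal) ≤ liminf (fun t : ℕ =>
      (((r t : ℝ) / ((a * t + b).choose k : ℝ) : ℝ) : EReal)) atTop := by
  have hl := ((continuous_coe_real_ereal.tendsto _).comp
    (tendsto_choose_div_choose_linear k a b ha)).liminf_eq
  rw [← hl]
  refine liminf_le_liminf ?_
  filter_upwards [h] with t ht
  simp only [Function.comp_apply, EReal.coe_le_coe_iff]
  gcongr

/-! ### Circles in the smoothings of `linkWord t` -/

theorem length_linkWord (t : ℕ) : (linkWord t).length = 6 * t + 2 := by
  simp [linkWord, mul_comm]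

theorem linkWord_succ (t : ℕ) : linkWord (t + 1) = [0, 2, 1, 1, 1, 1] ++ linkWord t := by
  simp [linkWord, List.replicate_succ]

theorem getElem_linkWord (t k : ℕ) (h : k < (linkWord t).length) :
    (linkWord t)[k] = if k % 6 = 0 then 0 else if k % 6 = 1 then 2 else 1 := by
  induction t generalizing k with
  | zero =>
    have : k < 2 := by simpa [length_linkWord] using h
    interval_cases k <;> rfl
  | succ t ih =>
    simp only [linkWord_succ]
    rcases lt_or_ge k 6 with hk | hk
    · interval_cases k <;> rfl
    · rw [List.getElem_append_right (by simpa using hk)]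
      have h' : k - 6 < (linkWord t).length := by
        rw [length_linkWord] at h ⊢; omega
      have := ih (k - 6) h'
      rw [show k % 6 = (k - 6) % 6 by omega]
      exact this

section

variable {t : ℕ} (α : Vertex (linkWord t))

/-- The smoothing of the crossing with index `k` at `α`; indices that are out of range count as
1-smoothed. -/
def smoothing (k : ℕ) : Bool := if h : k < (linkWord t).length then α ⟨k, h⟩ else true

/-- The circle through the point at position `p` of level `l`. Levels are natural numbers, which
are meaningful up to the length of the word and taken modulo the number of levels beyond it. -/
def node (l : ℕ) (p : Fin 4) : Circle (linkWord t) α :=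
  circleAt _ α (Fin.ofNat ((linkWord t).length + 1) l, p)

variable {α}

@[simp] theorem smoothing_val (c : Fin (linkWord t).length) : smoothing α c = α c := by
  simp [smoothing]

theorem castSucc_eq_ofNat {n : ℕ} (c : Fin n) : c.castSucc = Fin.ofNat (n + 1) c := by
  ext; simp

theorem succ_eq_ofNat {n : ℕ} (c : Fin n) : c.succ = Fin.ofNat (n + 1) (c + 1) := by
  ext; simp [Nat.mod_eq_of_lt (Nat.succ_lt_succ c.2)]

theorem circleAt_botLeft (c : Fin (linkWord t).length) :
    circleAt _ α (botLeft _ c) = node α c ((linkWord t).get c).castSucc := by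
  rw [node, ← castSucc_eq_ofNat]; rfl

theorem circleAt_botRight (c : Fin (linkWord t).length) :
    circleAt _ α (botRight _ c) = node α c ((linkWord t).get c).succ := by
  rw [node, ← castSucc_eq_ofNat]; rfl

theorem circleAt_topLeft (c : Fin (linkWord t).length) :
    circleAt _ α (topLeft _ c) = node α (c + 1) ((linkWord t).get c).castSucc := by
  rw [node, ← succ_eq_ofNat]; rfl

theorem circleAt_topRight (c : Fin (linkWord t).length) :
    circleAt _ α (topRight _ c) = node α (c + 1) ((linkWord t).get c).succ := by
  rw [node, ← succ_eq_ofNat]; rfl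

theorem node_strand (c : Fin (linkWord t).length) (p : Fin 4)
    (hl : p ≠ ((linkWord t).get c).castSucc) (hr : p ≠ ((linkWord t).get c).succ) :
    node α c p = node α (c + 1) p := by
  rw [node, node, ← castSucc_eq_ofNat, ← succ_eq_ofNat]
  exact Quot.sound (Arc.strand c p hl hr)

theorem node_vertical (c : Fin (linkWord t).length) (h : α c = false) :
    node α c ((linkWord t).get c).castSucc = node α (c + 1) ((linkWord t).get c).castSucc ∧
    node α c ((linkWord t).get c).succ = node α (c + 1) ((linkWord t).get c).succ := by
  rw [← circleAt_botLeft, ← circleAt_botRight, ← circleAt_topLeft, ← circleAt_topRight]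
  exact ⟨Quot.sound (Arc.left c (congrArg some h)), Quot.sound (Arc.right c (congrArg some h))⟩

theorem node_horizontal (c : Fin (linkWord t).length) (h : α c = true) :
    node α c ((linkWord t).get c).castSucc = node α c ((linkWord t).get c).succ ∧
    node α (c + 1) ((linkWord t).get c).castSucc = node α (c + 1) ((linkWord t).get c).succ := by
  rw [← circleAt_botLeft, ← circleAt_botRight, ← circleAt_topLeft, ← circleAt_topRight]
  exact ⟨Quot.sound (Arc.bottom c (congrArg some h)), Quot.sound (Arc.top c (congrArg some h))⟩

/-- The connections made by a crossing between the strands in positions `a` and `b` and the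
levels `k` and `k + 1`. -/
def Joins (α : Vertex (linkWord t)) (k : ℕ) (a b : Fin 4) : Prop :=
  if smoothing α k = true then node α k a = node α k b ∧ node α (k + 1) a = node α (k + 1) b
  else node α k a = node α (k + 1) a ∧ node α k b = node α (k + 1) b

theorem joins_get (c : Fin (linkWord t).length) :
    Joins α c ((linkWord t).get c).castSucc ((linkWord t).get c).succ := by
  rw [Joins, smoothing_val]
  split_ifs with h
  · exact node_horizontal c h
  · exact node_vertical c (by simpa using h)

theorem node_of_mod_zero {k : ℕ} (hk : k < 6 * t + 2) (h : k % 6 = 0) :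
    Joins α k 0 1 ∧ node α k 2 = node α (k + 1) 2 ∧ node α k 3 = node α (k + 1) 3 := by
  rw [← length_linkWord] at hk
  have hg : (linkWord t).get ⟨k, hk⟩ = 0 := by simp [getElem_linkWord, h]
  have h1 := joins_get (α := α) ⟨k, hk⟩
  have h2 := node_strand (α := α) ⟨k, hk⟩
  rw [hg] at h1 h2
  exact ⟨h1, h2 2 (by decide) (by decide), h2 3 (by decide) (by decide)⟩

theorem node_of_mod_one {k : ℕ} (hk : k < 6 * t + 2) (h : k % 6 = 1) :
    Joins α k 2 3 ∧ node α k 0 = node α (k + 1) 0 ∧ node α k 1 = node α (k + 1) 1 := by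
  rw [← length_linkWord] at hk
  have hg : (linkWord t).get ⟨k, hk⟩ = 2 := by simp [getElem_linkWord, h]
  have h1 := joins_get (α := α) ⟨k, hk⟩
  have h2 := node_strand (α := α) ⟨k, hk⟩
  rw [hg] at h1 h2
  exact ⟨h1, h2 0 (by decide) (by decide), h2 1 (by decide) (by decide)⟩

theorem node_of_two_le_mod {k : ℕ} (hk : k < 6 * t + 2) (h : 2 ≤ k % 6) :
    Joins α k 1 2 ∧ node α k 0 = node α (k + 1) 0 ∧ node α k 3 = node α (k + 1) 3 := by
  rw [← length_linkWord] at hk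
  have hg : (linkWord t).get ⟨k, hk⟩ = 1 := by
    simp [getElem_linkWord, show ¬ k % 6 = 0 by omega, show ¬ k % 6 = 1 by omega]
  have h1 := joins_get (α := α) ⟨k, hk⟩
  have h2 := node_strand (α := α) ⟨k, hk⟩
  rw [hg] at h1 h2
  exact ⟨h1, h2 0 (by decide) (by decide), h2 3 (by decide) (by decide)⟩

theorem splits_iff_mod_zero (c : Fin (linkWord t).length) (h : c.val % 6 = 0) :
    Splits _ α c ↔ node α c 0 = node α c 1 := by
  have hg : (linkWord t).get c = 0 := by simp [getElem_linkWord, h]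
  rw [Splits, circleAt_botLeft, circleAt_botRight, hg]; rfl

theorem splits_iff_mod_one (c : Fin (linkWord t).length) (h : c.val % 6 = 1) :
    Splits _ α c ↔ node α c 2 = node α c 3 := by
  have hg : (linkWord t).get c = 2 := by simp [getElem_linkWord, h]
  rw [Splits, circleAt_botLeft, circleAt_botRight, hg]; rfl

theorem get_of_two_le_mod (c : Fin (linkWord t).length) (h : 2 ≤ c.val % 6) :
    (linkWord t).get c = 1 := by
  simp [getElem_linkWord, show ¬ c.val % 6 = 0 by omega, show ¬ c.val % 6 = 1 by omega]

theorem splits_iff_two_le_mod (c : Fin (linkWord t).length) (h : 2 ≤ c.val % 6) :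
    Splits _ α c ↔ node α c 1 = node α c 2 := by
  rw [Splits, circleAt_botLeft, circleAt_botRight, get_of_two_le_mod c h]; rfl

/-- The left half of the outer circle of block `i` runs along the strand in position `0`, between
the 1-smoothed crossings `σ₁` of the block and of the next one. -/
theorem node_left_side {i : ℕ} (hi : i < t) (h0 : smoothing α (6 * i) = true)
    (h6 : smoothing α (6 * i + 6) = true) : node α (6 * i + 2) 1 = node α (6 * i + 6) 1 := by
  have e0 := (node_of_mod_zero (α := α) (k := 6 * i) (by omega) (by omega)).1
  have e1 := (node_of_mod_one (α := α) (k := 6 * i + 1) (by omega) (by omega)).2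
  have e2 := (node_of_two_le_mod (α := α) (k := 6 * i + 2) (by omega) (by omega)).2
  have e3 := (node_of_two_le_mod (α := α) (k := 6 * i + 3) (by omega) (by omega)).2
  have e4 := (node_of_two_le_mod (α := α) (k := 6 * i + 4) (by omega) (by omega)).2
  have e5 := (node_of_two_le_mod (α := α) (k := 6 * i + 5) (by omega) (by omega)).2
  have e6 := (node_of_mod_zero (α := α) (k := 6 * i + 6) (by omega) (by omega)).1
  simp only [Joins, h0, h6, if_true] at e0 e6
  grind

/-- The right half of the outer circle of block `i` runs along the strand in position `3`, between
the 1-smoothed crossings `σ₃` of the block and of the next one. -/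
theorem node_right_side {i : ℕ} (hi : i < t) (h1 : smoothing α (6 * i + 1) = true)
    (h7 : smoothing α (6 * i + 7) = true) : node α (6 * i + 2) 2 = node α (6 * i + 6) 2 := by
  have e1 := (node_of_mod_one (α := α) (k := 6 * i + 1) (by omega) (by omega)).1
  have e2 := (node_of_two_le_mod (α := α) (k := 6 * i + 2) (by omega) (by omega)).2
  have e3 := (node_of_two_le_mod (α := α) (k := 6 * i + 3) (by omega) (by omega)).2
  have e4 := (node_of_two_le_mod (α := α) (k := 6 * i + 4) (by omega) (by omega)).2
  have e5 := (node_of_two_le_mod (α := α) (k := 6 * i + 5) (by omega) (by omega)).2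
  have e6 := (node_of_mod_zero (α := α) (k := 6 * i + 6) (by omega) (by omega)).2
  have e7 := (node_of_mod_one (α := α) (k := 6 * i + 7) (by omega) (by omega)).1
  simp only [Joins, h1, h7, if_true] at e1 e7
  grind

/-- Crossings other than `c` are 1-smoothed, apart from at most one `σ₂` in each block. -/
structure Sparse (α : Vertex (linkWord t)) (c : ℕ) : Prop where
  outer : ∀ k, k % 6 < 2 → k ≠ c → smoothing α k = true
  inner : ∀ k l, k / 6 = l / 6 → k ≠ c → l ≠ c → k ≠ l → smoothing α k = true ∨ smoothing α l = true

/-- The two strands `u` and `v` through `σ₂⁴`, each closed up outside. Unless all four crossings are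
0-smoothed, the strands below every crossing lie on the same circle, since any 1-smoothed crossing
joins them. -/
theorem column {X : Type*} {u v : ℕ → X} {a : ℕ → Bool} {b : ℕ}
    (h : ∀ k, b ≤ k → k < b + 4 →
      if a k = true then u k = v k ∧ u (k + 1) = v (k + 1) else u k = u (k + 1) ∧ v k = v (k + 1))
    (hu : u b = u (b + 4)) (hv : v b = v (b + 4)) (ha : ∃ k, b ≤ k ∧ k < b + 4 ∧ a k = true) :
    ∀ k, b ≤ k → k < b + 4 → u k = v k := by
  have h0 := h b (by omega) (by omega)
  have h1 := h (b + 1) (by omega) (by omega)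
  have h2 := h (b + 2) (by omega) (by omega)
  have h3 := h (b + 3) (by omega) (by omega)
  clear h
  obtain ⟨k, hk, hk', ha⟩ := ha
  have ha : a b = true ∨ a (b + 1) = true ∨ a (b + 2) = true ∨ a (b + 3) = true := by
    obtain rfl | rfl | rfl | rfl : k = b ∨ k = b + 1 ∨ k = b + 2 ∨ k = b + 3 := by omega
    all_goals simp [ha]
  intro l hl hl'
  obtain rfl | rfl | rfl | rfl : l = b ∨ l = b + 1 ∨ l = b + 2 ∨ l = b + 3 := by omega
  all_goals grind

/-- If at most one crossing of a block is 0-smoothed, then the two ends of `σ₂⁴` are joined. -/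
theorem column_ends {X : Type*} {u v : ℕ → X} {a : ℕ → Bool} {b : ℕ}
    (h : ∀ k, b ≤ k → k < b + 4 →
      if a k = true then u k = v k ∧ u (k + 1) = v (k + 1) else u k = u (k + 1) ∧ v k = v (k + 1))
    (h01 : a b = true ∨ a (b + 1) = true) (h23 : a (b + 2) = true ∨ a (b + 3) = true) :
    u b = v b ∧ u (b + 4) = v (b + 4) := by
  have h0 := h b (by omega) (by omega)
  have h1 := h (b + 1) (by omega) (by omega)
  have h2 := h (b + 2) (by omega) (by omega)
  have h3 := h (b + 3) (by omega) (by omega)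
  clear h
  grind

theorem joins_column {i : ℕ} (hi : i < t) (k : ℕ) (hk : 6 * i + 2 ≤ k) (hk' : k < 6 * i + 2 + 4) :
    Joins α k 1 2 :=
  (node_of_two_le_mod (α := α) (by omega) (by omega)).1

/-- At a sparse vertex, the two bottom ends of `c` are on the same circle: if `c` is a `σ₂`, its
column is closed up by both halves of the outer circle; otherwise, one runs once around an adjacent
block. -/
theorem Sparse.splits (c : Fin (linkWord t).length) (ht : 0 < t) (h : Sparse α c) :
    Splits _ α c := by
  have hc : c.val < 6 * t + 2 := length_linkWord t ▸ c.2
  by_cases h2 : 2 ≤ c.val % 6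
  · rw [splits_iff_two_le_mod c h2]
    obtain ⟨i, hi⟩ : ∃ i, c.val / 6 = i := ⟨_, rfl⟩
    refine column (joins_column (i := i) (by omega)) ?_ ?_ ?_ c (by omega) (by omega)
    · exact node_left_side (by omega) (h.outer _ (by omega) (by omega))
        (h.outer _ (by omega) (by omega))
    · exact node_right_side (by omega) (h.outer _ (by omega) (by omega))
        (h.outer _ (by omega) (by omega))
    · by_contra! hn
      by_cases h3 : c.val = 6 * i + 2
      · have := h.inner (6 * i + 3) (6 * i + 4) (by omega) (by omega) (by omega) (by omega)
        rcases this with h' | h'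
        exacts [hn _ (by omega) (by omega) h', hn _ (by omega) (by omega) h']
      by_cases h4 : c.val = 6 * i + 3
      · have := h.inner (6 * i + 2) (6 * i + 4) (by omega) (by omega) (by omega) (by omega)
        rcases this with h' | h'
        exacts [hn _ (by omega) (by omega) h', hn _ (by omega) (by omega) h']
      · have := h.inner (6 * i + 2) (6 * i + 3) (by omega) (by omega) (by omega) (by omega)
        rcases this with h' | h'
        exacts [hn _ (by omega) (by omega) h', hn _ (by omega) (by omega) h']
  -- An outer crossing: use the block above it, or below it for the last two crossings.
  obtain ⟨i, hi, hci⟩ : ∃ i < t, c.val = 6 * i ∨ c.val = 6 * i + 1 ∨ c.val = 6 * i + 6 ∨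
      c.val = 6 * i + 7 := by
    rcases lt_or_ge (c.val / 6) t with h' | h'
    · exact ⟨c.val / 6, h', by omega⟩
    · exact ⟨t - 1, by omega, by omega⟩
  have e0 := node_of_mod_zero (α := α) (k := 6 * i) (by omega) (by omega)
  have e1 := node_of_mod_one (α := α) (k := 6 * i + 1) (by omega) (by omega)
  have e2 := (node_of_two_le_mod (α := α) (k := 6 * i + 2) (by omega) (by omega)).2
  have e3 := (node_of_two_le_mod (α := α) (k := 6 * i + 3) (by omega) (by omega)).2
  have e4 := (node_of_two_le_mod (α := α) (k := 6 * i + 4) (by omega) (by omega)).2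
  have e5 := (node_of_two_le_mod (α := α) (k := 6 * i + 5) (by omega) (by omega)).2
  have e6 := node_of_mod_zero (α := α) (k := 6 * i + 6) (by omega) (by omega)
  have e7 := node_of_mod_one (α := α) (k := 6 * i + 7) (by omega) (by omega)
  have hcol := column_ends (joins_column (α := α) hi)
    (h.inner (6 * i + 2) (6 * i + 3) (by omega) (by omega) (by omega) (by omega))
    (h.inner (6 * i + 4) (6 * i + 5) (by omega) (by omega) (by omega) (by omega))
  have o0 := h.outer (6 * i) (by omega)
  have o1 := h.outer (6 * i + 1) (by omega)
  have o6 := h.outer (6 * i + 6) (by omega)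
  have o7 := h.outer (6 * i + 7) (by omega)
  simp only [Joins] at e0 e1 e6 e7
  rcases hci with hci | hci | hci | hci
  · rw [splits_iff_mod_zero c (by omega), hci]
    rw [if_pos (o1 (by omega))] at e1
    rw [if_pos (o6 (by omega))] at e6
    rw [if_pos (o7 (by omega))] at e7
    grind
  · rw [splits_iff_mod_one c (by omega), hci]
    rw [if_pos (o0 (by omega))] at e0
    rw [if_pos (o6 (by omega))] at e6
    rw [if_pos (o7 (by omega))] at e7
    grind
  · rw [splits_iff_mod_zero c (by omega), hci]
    rw [if_pos (o0 (by omega))] at e0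
    rw [if_pos (o1 (by omega))] at e1
    rw [if_pos (o7 (by omega))] at e7
    grind
  · rw [splits_iff_mod_one c (by omega), hci]
    rw [if_pos (o0 (by omega))] at e0
    rw [if_pos (o1 (by omega))] at e1
    rw [if_pos (o6 (by omega))] at e6
    grind

end

/-! ### Transversal vertices -/

section

variable {t : ℕ}

/-- `α` has precisely one 0-smoothing in each block of `S`, at one of its crossings `σ₂`, and is
1-smoothed at all other crossings. -/
structure IsTransversal (S : Finset ℕ) (α : Vertex (linkWord t)) : Prop where
  inner_mem : ∀ c, α c = false → 2 ≤ c.val % 6 ∧ c.val / 6 ∈ S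
  existsUnique : ∀ i ∈ S, ∃! c, c.val / 6 = i ∧ α c = false

/-- The vertex with 0-smoothings at the first `σ₂` of each block of `S`. -/
def firstVertex (t : ℕ) (S : Finset ℕ) : Vertex (linkWord t) :=
  fun c => !decide (c.val % 6 = 2 ∧ c.val / 6 ∈ S)

theorem firstVertex_eq_false {S : Finset ℕ} {c : Fin (linkWord t).length} :
    firstVertex t S c = false ↔ c.val % 6 = 2 ∧ c.val / 6 ∈ S := by
  simp [firstVertex]

theorem isTransversal_firstVertex {S : Finset ℕ} (hS : ∀ i ∈ S, i < t) :
    IsTransversal S (firstVertex t S) where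
  inner_mem c hc := by
    rw [firstVertex_eq_false] at hc
    exact ⟨by omega, hc.2⟩
  existsUnique i hi := by
    have := hS i hi
    refine ⟨⟨6 * i + 2, by rw [length_linkWord]; omega⟩, ⟨?_, ?_⟩, ?_⟩
    · change (6 * i + 2) / 6 = i
      omega
    · rw [firstVertex_eq_false]
      change (6 * i + 2) % 6 = 2 ∧ (6 * i + 2) / 6 ∈ S
      rw [show (6 * i + 2) / 6 = i by omega]
      exact ⟨by omega, hi⟩
    · rintro c ⟨hc, hc'⟩
      rw [firstVertex_eq_false] at hc'
      ext
      change c.val = 6 * i + 2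
      omega

/-- Among block sets of a fixed size, `S` is the only one whose transversal chain involves the
first vertex of `S`; this makes the pairing of chains with augmentations the identity matrix. -/
theorem isTransversal_firstVertex_iff {S S' : Finset ℕ} (hS : ∀ i ∈ S, i < t)
    (hcard : S'.card = S.card) : IsTransversal S' (firstVertex t S) ↔ S = S' := by
  refine ⟨fun h => Finset.eq_of_subset_of_card_le (fun i hi => ?_) hcard.le, ?_⟩
  · have := hS i hi
    have hc : firstVertex t S ⟨6 * i + 2, by rw [length_linkWord]; omega⟩ = false := by
      rw [firstVertex_eq_false]
      change (6 * i + 2) % 6 = 2 ∧ (6 * i + 2) / 6 ∈ S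
      rw [show (6 * i + 2) / 6 = i by omega]
      exact ⟨by omega, hi⟩
    have h2 := (h.inner_mem _ hc).2
    rwa [show (6 * i + 2) / 6 = i by omega] at h2
  · rintro rfl
    exact isTransversal_firstVertex hS

variable {S : Finset ℕ} {α : Vertex (linkWord t)}

/-- Changing `c` arbitrarily and further crossings from 0 to 1 keeps a transversal vertex
sparse. -/
theorem IsTransversal.sparse (hα : IsTransversal S α) {β : Vertex (linkWord t)}
    {c : Fin (linkWord t).length} (hβ : ∀ e ≠ c, α e = true → β e = true) : Sparse β c := by
  have key : ∀ k : ℕ, k ≠ c.val → smoothing β k ≠ true → ∃ e : Fin _, e.val = k ∧ α e = false := by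
    intro k hk hs
    rw [smoothing] at hs
    split_ifs at hs with hlt
    · refine ⟨⟨k, hlt⟩, rfl, ?_⟩
      by_contra hne
      exact hs (hβ _ (fun h => hk (congrArg Fin.val h)) (by simpa using hne))
    · exact absurd rfl hs
  constructor
  · intro k hk hkc
    by_contra hs
    obtain ⟨e, rfl, he⟩ := key k hkc hs
    have := (hα.inner_mem e he).1
    omega
  · intro k l hkl hk hl hne
    by_contra! hs
    obtain ⟨e, rfl, he⟩ := key k hk hs.1
    obtain ⟨f, rfl, hf⟩ := key l hl hs.2
    exact hne (congrArg Fin.val ((hα.existsUnique _ (hα.inner_mem e he).2).unique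
      ⟨rfl, he⟩ ⟨hkl.symm, hf⟩))

theorem IsTransversal.pos (hα : IsTransversal S α) {c : Fin (linkWord t).length}
    (hc : α c = false) : 0 < t := by
  have h1 := (hα.inner_mem c hc).1
  have h2 : c.val < 6 * t + 2 := length_linkWord t ▸ c.2
  omega

theorem IsTransversal.height_add_card (hα : IsTransversal S α) :
    height _ α + S.card = crossings (linkWord t) := by
  have h : S.card = (Finset.univ.filter fun c => ¬ α c = true).card := by
    symm
    refine Finset.card_bij (fun c _ => c.val / 6) ?_ ?_ ?_
    · intro c hc
      exact (hα.inner_mem c (by simpa using hc)).2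
    · intro c hc d hd h
      have hc : α c = false := by simpa using hc
      exact (hα.existsUnique _ (hα.inner_mem c hc).2).unique ⟨rfl, hc⟩
        ⟨h.symm, by simpa using hd⟩
    · intro i hi
      obtain ⟨c, ⟨hc, hc'⟩, -⟩ := hα.existsUnique i hi
      exact ⟨c, by simpa using hc', hc⟩
  rw [h, height, Finset.card_filter_add_card_filter_not, Finset.card_univ, Fintype.card_fin,
    crossings]

theorem IsTransversal.splits (hα : IsTransversal S α) {c : Fin (linkWord t).length}
    (hc : α c = false) : Splits _ α c :=
  (hα.sparse fun _ _ h => h).splits c (hα.pos hc)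

/-- Moving the 0-smoothing within its block preserves transversality. -/
theorem IsTransversal.move {β : Vertex (linkWord t)} {c d : Fin (linkWord t).length}
    (hc : IsTransversal S (Function.update β c false)) (hβ : β c = true) (hd : 2 ≤ d.val % 6)
    (hcd : d.val / 6 = c.val / 6) :
    β d = true ∧ IsTransversal S (Function.update β d false) := by
  have hcS : c.val / 6 ∈ S := (hc.inner_mem c (by simp)).2
  have hblock : ∀ e, e.val / 6 = c.val / 6 → β e = true := by
    intro e he
    by_contra hne
    have hec : e ≠ c := by rintro rfl; exact hne hβ
    exact hec ((hc.existsUnique _ hcS).unique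
      ⟨he, by rw [Function.update_of_ne hec]; simpa using hne⟩ ⟨rfl, by simp⟩)
  refine ⟨hblock d hcd, fun e he => ?_, fun i hi => ?_⟩
  · by_cases hed : e = d
    · subst hed
      exact ⟨hd, hcd ▸ hcS⟩
    · rw [Function.update_of_ne hed] at he
      refine hc.inner_mem e ?_
      rw [Function.update_of_ne (by rintro rfl; simp [hβ] at he)]
      exact he
  · by_cases hic : i = c.val / 6
    · refine ⟨d, ⟨by omega, by simp⟩, ?_⟩
      rintro e ⟨he, he'⟩
      by_contra hed
      rw [Function.update_of_ne hed, hblock e (by omega)] at he'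
      exact Bool.noConfusion he'
    · obtain ⟨e, ⟨he, he'⟩, hu⟩ := hc.existsUnique i hi
      have aux : ∀ e : Fin (linkWord t).length, e.val / 6 = i →
          Function.update β c false e = Function.update β d false e := by
        intro e he
        rw [Function.update_of_ne (by rintro rfl; omega),
          Function.update_of_ne (by rintro rfl; omega)]
      exact ⟨e, ⟨he, aux e he ▸ he'⟩, fun f hf => hu f ⟨hf.1, (aux f hf.1).trans hf.2⟩⟩

theorem sum_block {M : Type*} [AddCommMonoid M] {i : ℕ} (hi : i < t) (G : ℕ → M) :
    ∑ c : Fin (linkWord t).length with c.val / 6 = i ∧ 2 ≤ c.val % 6, G c =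
      ∑ j ∈ Finset.range 4, G (6 * i + 2 + j) := by
  refine Finset.sum_bij' (fun c _ => c.val - (6 * i + 2))
    (fun j hj => ⟨6 * i + 2 + j, by
      rw [length_linkWord]
      have := Finset.mem_range.1 hj
      omega⟩) ?_ ?_ ?_ ?_ ?_
  · intro c hc
    simp only [Finset.mem_filter, Finset.mem_univ, true_and] at hc
    rw [Finset.mem_range]
    omega
  · intro j hj
    have := Finset.mem_range.1 hj
    simp only [Finset.mem_filter, Finset.mem_univ, true_and]
    omega
  · intro c hc
    simp only [Finset.mem_filter, Finset.mem_univ, true_and] at hc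
    ext
    change 6 * i + 2 + (c.val - (6 * i + 2)) = c.val
    omega
  · intro j _
    change 6 * i + 2 + j - (6 * i + 2) = j
    omega
  · intro c hc
    simp only [Finset.mem_filter, Finset.mem_univ, true_and] at hc
    congr 1
    omega

/-! ### The transversal chains -/

section Chain

variable {V : Vertex (linkWord t) → Type} [∀ α, AddCommGroup (V α)]

open Classical in
/-- The sum of the elements `one α` over the transversal vertices `α` of `S`. -/
def transversalChain (V : Vertex (linkWord t) → Type) [∀ α, AddCommGroup (V α)]
    (one : ∀ α, V α) (S : Finset ℕ) : ∀ α, V α :=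
  fun α => if IsTransversal S α then one α else 0

theorem transversalChain_mem_degreePart (one : ∀ α, V α) (S : Finset ℕ) :
    transversalChain V one S ∈
      degreePart (linkWord t) V ((crossings (linkWord t) : ℤ) - (S.card : ℤ)) := by
  intro α hα
  refine if_neg fun h => hα ?_
  have := h.height_add_card
  omega

/-- The transversal chain of `S` is a cycle as soon as, at every vertex `β` and block `i` such that
0-smoothing any `σ₂` of the block gives a transversal vertex of `S`, the images of `one` along the
four corresponding edges cancel. The function `G` extends these images to all levels. -/
theorem cubeDiff_transversalChain_eq_zero
    (edge : ∀ α β : Vertex (linkWord t), Fin (linkWord t).length → (V α →ₗ[ℤ] V β))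
    (sign : Vertex (linkWord t) → Fin (linkWord t).length → ℤ) (one : ∀ α, V α) {S : Finset ℕ}
    (hS : ∀ i ∈ S, i < t)
    (h : ∀ β i, i < t → (∀ c : Fin (linkWord t).length, c.val / 6 = i → 2 ≤ c.val % 6 →
        β c = true ∧ IsTransversal S (Function.update β c false)) →
      ∃ G : ℕ → V β, (∀ c : Fin (linkWord t).length, c.val / 6 = i → 2 ≤ c.val % 6 →
        sign (Function.update β c false) c • edge (Function.update β c false) β c (one _) = G c) ∧
        ∑ j ∈ Finset.range 4, G (6 * i + 2 + j) = 0) :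
    cubeDiff _ V edge sign (transversalChain V one S) = 0 := by
  classical
  funext β
  rw [cubeDiff_apply]
  by_cases hex : ∃ c, β c = true ∧ IsTransversal S (Function.update β c false)
  · obtain ⟨c₀, hβ, hc₀⟩ := hex
    have h₀ := hc₀.inner_mem c₀ (by simp)
    have hmove : ∀ c : Fin (linkWord t).length, c.val / 6 = c₀.val / 6 → 2 ≤ c.val % 6 →
        β c = true ∧ IsTransversal S (Function.update β c false) :=
      fun c h1 h2 => hc₀.move hβ h2 h1
    obtain ⟨G, hG, hsum⟩ := h β _ (hS _ h₀.2) hmove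
    refine Eq.trans ?_ ((sum_block (hS _ h₀.2) G).trans hsum)
    symm
    refine Finset.sum_subset_zero_on_sdiff ?_ ?_ ?_
    · intro c hc
      simp only [Finset.mem_filter, Finset.mem_univ, true_and] at hc ⊢
      exact (hmove c hc.1 hc.2).1
    · intro c hc
      simp only [Finset.mem_sdiff, Finset.mem_filter, Finset.mem_univ, true_and] at hc
      rw [transversalChain, if_neg, map_zero, smul_zero]
      intro hT
      refine hc.2 ⟨?_, (hT.inner_mem c (by simp)).1⟩
      -- The block of `c₀` has a 0-smoothing in `update β c false`, which can only be `c`.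
      obtain ⟨e, ⟨he, he'⟩, -⟩ := hT.existsUnique _ h₀.2
      by_cases hec : e = c
      · rw [← hec, he]
      · have hi := hT.inner_mem e he'
        rw [Function.update_of_ne hec, (hmove e he hi.1).1] at he'
        exact Bool.noConfusion he'
    · intro c hc
      simp only [Finset.mem_filter, Finset.mem_univ, true_and] at hc
      rw [transversalChain, if_pos (hmove c hc.1 hc.2).2, hG c hc.1 hc.2]
  · refine Finset.sum_eq_zero fun c hc => ?_
    rw [transversalChain, if_neg, map_zero, smul_zero]
    · exact fun hT => hex ⟨c, by simpa using hc, hT⟩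

end Chain

/-- Every edge of the cube that ends at `firstVertex t S` is a split, so the augmentation at this
vertex vanishes on boundaries. -/
theorem splits_update_firstVertex (ht : 0 < t) (hS : ∀ i ∈ S, i < t)
    (c : Fin (linkWord t).length) :
    Splits _ (Function.update (firstVertex t S) c false) c :=
  ((isTransversal_firstVertex hS).sparse fun e he h => by
    rwa [Function.update_of_ne he]).splits c ht

theorem circleAt_topLeft_of_inner (c : Fin (linkWord t).length) (hc : 2 ≤ c.val % 6) :
    circleAt _ α (topLeft _ c) = node α (c + 1) 1 := by
  rw [circleAt_topLeft, get_of_two_le_mod c hc]; rfl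

theorem circleAt_botLeft_of_inner (c : Fin (linkWord t).length) (hc : 2 ≤ c.val % 6) :
    circleAt _ α (botLeft _ c) = node α c 1 := by
  rw [circleAt_botLeft, get_of_two_le_mod c hc]; rfl

/-- The circle below the first `σ₂` of a block is the circle above its last `σ₂`, provided that
the block can be 0-smoothed to a transversal vertex. -/
theorem node_block_closed {β : Vertex (linkWord t)} {i : ℕ} (hi : i < t)
    (h : ∀ c : Fin (linkWord t).length, c.val / 6 = i → 2 ≤ c.val % 6 →
        β c = true ∧ IsTransversal S (Function.update β c false)) :
    node β (6 * i + 2) 1 = node β (6 * i + 2 + 4) 1 := by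
  have hc := (h ⟨6 * i + 2, by rw [length_linkWord]; omega⟩
    (by change (6 * i + 2) / 6 = i; omega) (by change 2 ≤ (6 * i + 2) % 6; omega)).2
  have hs := hc.sparse (β := β) (c := ⟨6 * i + 2, by rw [length_linkWord]; omega⟩)
    fun e he h => by rwa [Function.update_of_ne he] at h
  exact node_left_side hi (hs.outer _ (by omega) (by simp)) (hs.outer _ (by omega) (by simp))

/-! ### Edge signs -/

/-- At all the faces that enter the sign, both crossings split and still do so after the other one
has been changed. -/
theorem oddSign_of_isTransversal (hα : IsTransversal S α) (c : Fin (linkWord t).length)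
    (hc : α c = false) : oddSign _ α c = 1 := by
  have ht := hα.pos hc
  refine Finset.prod_eq_one fun d hd => ?_
  have hfill : ∀ e, α e = true → fillAbove _ α d e = true := by
    intro e he
    simp [fillAbove, he]
  rw [faceSign, if_pos, if_pos, if_pos]
  · refine (hα.sparse fun e _ he => ?_).splits d ht
    by_cases hec : e = c
    · rw [hec, Function.update_self]
    · rw [Function.update_of_ne hec, hfill e he]
  · exact (hα.sparse fun e _ he => hfill e he).splits d ht
  · exact (hα.sparse fun e _ he => hfill e he).splits c ht

/-- The number of 1-smoothings at `α` among the crossings with index less than `k`. -/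
def onesBelow (α : Vertex (linkWord t)) (k : ℕ) : ℕ :=
  (Finset.univ.filter fun e : Fin (linkWord t).length => e.val < k ∧ α e = true).card

theorem onesBelow_succ (c : Fin (linkWord t).length) (hc : α c = true) :
    onesBelow α (c + 1) = onesBelow α c + 1 := by
  rw [onesBelow, onesBelow, ← Finset.card_insert_of_notMem (a := c) (by simp)]
  congr 1
  ext e
  simp only [Finset.mem_filter, Finset.mem_univ, true_and, Finset.mem_insert]
  constructor
  · rintro ⟨h1, h2⟩
    rcases Nat.lt_succ_iff_lt_or_eq.1 h1 with h | h
    exacts [Or.inr ⟨h, h2⟩, Or.inl (Fin.ext h)]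
  · rintro (rfl | ⟨h1, h2⟩)
    exacts [⟨Nat.lt_succ_self _, hc⟩, ⟨by omega, h2⟩]

theorem evenSign_update (c : Fin (linkWord t).length) :
    evenSign _ (Function.update α c false) c = (-1) ^ onesBelow α c := by
  rw [evenSign, onesBelow]
  congr 2
  ext e
  simp only [Finset.mem_filter, Finset.mem_univ, true_and, Fin.lt_def]
  refine and_congr_right fun h => ?_
  rw [Function.update_of_ne (by rintro rfl; omega)]

/-! ### The transversal chains are cycles -/

theorem oddDiff_transversalChain (hS : ∀ i ∈ S, i < t) :
    oddDiff (linkWord t) (transversalChain _ (fun _ => 1) S) = 0 := by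
  refine cubeDiff_transversalChain_eq_zero _ _ _ hS fun β i hi h =>
    ⟨fun k => oddX (node β k 1) - oddX (node β (k + 1) 1), fun c hci hc => ?_, ?_⟩
  · obtain ⟨-, hT⟩ := h c hci hc
    rw [oddSign_of_isTransversal hT c (by simp), one_smul,
      oddEdge_one _ _ _ _ (hT.splits (by simp)), circleAt_botLeft_of_inner c hc,
      circleAt_topLeft_of_inner c hc]
  · refine (Finset.sum_range_sub' (fun j => oddX (node β (6 * i + 2 + j) 1)) 4).trans ?_
    rw [add_zero, ← node_block_closed hi h, sub_self]

theorem evenDiff_transversalChain (hS : ∀ i ∈ S, i < t) :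
    evenDiff (linkWord t) (transversalChain _ (fun _ => 1) S) = 0 := by
  refine cubeDiff_transversalChain_eq_zero _ _ _ hS fun β i hi h =>
    ⟨fun k => (-1 : ℤ) ^ onesBelow β k • (evenX (node β k 1) + evenX (node β (k + 1) 1)),
      fun c hci hc => ?_, ?_⟩
  · obtain ⟨-, hT⟩ := h c hci hc
    rw [evenSign_update, evenEdge_one _ _ _ _ (hT.splits (by simp)),
      circleAt_botLeft_of_inner c hc, circleAt_topLeft_of_inner c hc]
  · have hones : ∀ j < 4, onesBelow β (6 * i + 2 + (j + 1)) = onesBelow β (6 * i + 2 + j) + 1 := by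
      intro j hj
      refine onesBelow_succ ⟨6 * i + 2 + j, by rw [length_linkWord]; omega⟩ (h _ ?_ ?_).1
      · change (6 * i + 2 + j) / 6 = i
        omega
      · change 2 ≤ (6 * i + 2 + j) % 6
        omega
    have h0 := hones 0 (by omega)
    have h1 := hones 1 (by omega)
    have h2 := hones 2 (by omega)
    have h3 := node_block_closed hi h
    simp only [Finset.sum_range_succ, Finset.sum_range_zero, zero_add, add_zero, Nat.reduceAdd,
      add_assoc] at h0 h1 h2 h3 ⊢
    -- The signs alternate, so that the sum telescopes.
    rw [h2, h1, h0, ← h3]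
    simp only [pow_succ, mul_neg, mul_one, neg_neg, neg_smul, smul_add]
    abel

end

/-! ### The rank bounds -/

/-- The common part of the even and the odd case: `aug` vanishes on the images of splits, and the
transversal chains of `one` are cycles. -/
theorem choose_le_finrank_cubeHomology {t : ℕ} (ht : 0 < t) (k : ℕ)
    (V : Vertex (linkWord t) → Type) [∀ α, AddCommGroup (V α)] [∀ α, Module.Finite ℤ (V α)]
    (edge : ∀ α β : Vertex (linkWord t), Fin (linkWord t).length → (V α →ₗ[ℤ] V β))
    (sign : Vertex (linkWord t) → Fin (linkWord t).length → ℤ) (one : ∀ α, V α)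
    (aug : ∀ α, V α →ₗ[ℤ] ℤ) (haug : ∀ α, aug α (one α) = 1)
    (hedge : ∀ α β c, Splits _ α c → ∀ x, aug β (edge α β c x) = 0)
    (hcycle : ∀ S : Finset ℕ, (∀ i ∈ S, i < t) →
      cubeDiff _ V edge sign (transversalChain V one S) = 0) :
    t.choose k ≤ Module.finrank ℤ (CubeHomology (linkWord t) V (cubeDiff _ V edge sign)
      ((crossings (linkWord t) : ℤ) - (k : ℤ))) := by
  classical
  have hmem : ∀ S : Finset.powersetCard k (Finset.range t), (∀ i ∈ S.1, i < t) ∧ S.1.card = k :=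
    fun S => ⟨fun i hi => Finset.mem_range.1 ((Finset.mem_powersetCard.1 S.2).1 hi),
      (Finset.mem_powersetCard.1 S.2).2⟩
  have h := card_le_finrank_cubeHomology (linkWord t) V (cubeDiff _ V edge sign)
    ((crossings (linkWord t) : ℤ) - (k : ℤ))
    (ι := Finset.powersetCard k (Finset.range t))
    (fun S => transversalChain V one S.1)
    (fun S => aug (firstVertex t S.1) ∘ₗ LinearMap.proj (firstVertex t S.1))
    (fun S => hcycle _ (hmem S).1)
    (fun S => by
      have := transversalChain_mem_degreePart (V := V) one S.1
      rwa [(hmem S).2] at this)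
    (fun S v => by
      rw [LinearMap.comp_apply, LinearMap.proj_apply, cubeDiff_apply, map_sum]
      refine Finset.sum_eq_zero fun c _ => ?_
      rw [map_smul, hedge _ _ _ (splits_update_firstVertex ht (hmem S).1 c), smul_zero])
    (fun S S' => by
      rw [LinearMap.comp_apply, LinearMap.proj_apply, transversalChain]
      have := isTransversal_firstVertex_iff (hmem S).1 ((hmem S').2.trans (hmem S).2.symm)
      by_cases hSS : S = S'
      · rw [if_pos (this.2 (congrArg _ hSS)), if_pos hSS, haug]
      · rw [if_neg fun h => hSS (Subtype.ext (this.1 h)), if_neg hSS, map_zero])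
  simpa using h

theorem choose_le_finrank_kh {t : ℕ} (ht : 0 < t) (k : ℕ) : t.choose k ≤
    Module.finrank ℤ (Kh (linkWord t) ((crossings (linkWord t) : ℤ) - (k : ℤ))) :=
  choose_le_finrank_cubeHomology ht k _ _ _ (fun _ => 1) (fun _ => (evenAug _).toLinearMap)
    (fun _ => map_one (evenAug _)) (fun α β c h x => evenAug_evenEdge _ α β c h x)
    fun _ hS => evenDiff_transversalChain hS

theorem choose_le_finrank_oddKh {t : ℕ} (ht : 0 < t) (k : ℕ) : t.choose k ≤
    Module.finrank ℤ (OddKh (linkWord t) ((crossings (linkWord t) : ℤ) - (k : ℤ))) :=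
  choose_le_finrank_cubeHomology ht k _ _ _ (fun _ => 1) (fun _ => (oddAug _).toLinearMap)
    (fun _ => map_one (oddAug _)) (fun α β c h x => oddAug_oddEdge _ α β c h x)
    fun _ hS => oddDiff_transversalChain hS

end

end Khovanov

theorem mainTheorem5 (k : ℕ) :
    ((((1 / 6 : ℝ) ^ k : ℝ) : EReal) ≤
      Filter.liminf (fun t : ℕ =>
        (((Module.finrank ℤ (Khovanov.Kh (Khovanov.linkWord t)
              ((Khovanov.crossings (Khovanov.linkWord t) : ℤ) - (k : ℤ))) : ℝ) /
            (Nat.choose (Khovanov.crossings (Khovanov.linkWord t)) k : ℝ) : ℝ) : EReal))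
        Filter.atTop) ∧
    ((((1 / 6 : ℝ) ^ k : ℝ) : EReal) ≤
      Filter.liminf (fun t : ℕ =>
        (((Module.finrank ℤ (Khovanov.OddKh (Khovanov.linkWord t)
              ((Khovanov.crossings (Khovanov.linkWord t) : ℤ) - (k : ℤ))) : ℝ) /
            (Nat.choose (Khovanov.crossings (Khovanov.linkWord t)) k : ℝ) : ℝ) : EReal))
        Filter.atTop) := by
  have hn : ∀ t, (Khovanov.crossings (Khovanov.linkWord t)).choose k = (6 * t + 2).choose k :=
    fun t => by rw [Khovanov.crossings, Khovanov.length_linkWord]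
  simp only [hn]
  constructor
  · refine Khovanov.le_liminf_div_choose k 6 2 (by norm_num) (fun t => Module.finrank ℤ
      (Khovanov.Kh (Khovanov.linkWord t)
        ((Khovanov.crossings (Khovanov.linkWord t) : ℤ) - (k : ℤ)))) ?_
    filter_upwards [Filter.eventually_gt_atTop 0] with t ht
    exact Khovanov.choose_le_finrank_kh ht k
  · refine Khovanov.le_liminf_div_choose k 6 2 (by norm_num) (fun t => Module.finrank ℤ
      (Khovanov.OddKh (Khovanov.linkWord t)
        ((Khovanov.crossings (Khovanov.linkWord t) : ℤ) - (k : ℤ)))) ?_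
    filter_upwards [Filter.eventually_gt_atTop 0] with t ht
    exact Khovanov.choose_le_finrank_oddKh ht k
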